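/- Let $\mathbb K\in\{\mathbb R,\mathbb C\}$, let $\mathscr M=\{M_1,\dots,M_r\}$ be a finite family of $d\times d$ matrices over $\mathbb K$, let $\|\cdot\|$ be a sub-multiplicative norm on $\mathbb K^{d\times d}$, let $\ell\ge 1$ be an integer, and let $p_i>0$ with $\sum_{i=1}^r p_i=1$ and $0\le p_i^-<p_i<p_i^+\le 1$ for $i=1,\dots,r$. Let $\mathscr A=\{1,\dots,r\}$, and for a finite sequence $\alpha$ of symbols of $\mathscr A$ let $|\alpha|_i$ be the number of occurrences of $i$ in $\alpha$. Let $\mathscr A_\ell(p^\pm)$ be the set of all $\alpha\in\mathscr A^\ell$ with $p_i^-\le |\alpha|_i/\ell\le p_i^+$ for all $i$, and let $\mathscr A_\ell^{\mathbb N}(p^\pm)$ be the set of all infinite sequences $(\alpha_k)_{k\ge0}$ in $\mathscr A$ each of whose blocks of $\ell$ consecutive symbols belongs to $\mathscr A_\ell(p^\pm)$. A finite sequence of length $n\ge 1$ is called admissible if it is an initial interval of some sequence in $\mathscr A_\ell^{\mathbb N}(p^\pm)$, and periodically extendable if it is the initial interval of some $n$-periodic sequence in $\mathscr A_\ell^{\mathbb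 N}(p^\pm)$. For $n\ge1$ put $$\rho_n:=\sup\|M_{\alpha_n}\cdots M_{\alpha_1}\|^{1/n},\qquad \hat\rho_n:=\sup\rho(M_{\alpha_n}\cdots M_{\alpha_1})^{1/n},\qquad \hat\rho_n^{(\mathrm{per})}:=\sup\rho(M_{\alpha_n}\cdots M_{\alpha_1})^{1/n},$$ where $\rho(\cdot)$ of a matrix is its spectral radius (the largest modulus of its complex eigenvalues), the first two suprema are over all admissible sequences $(\alpha_1,\dots,\alpha_n)$, the third is over all periodically extendable admissible sequences $(\alpha_1,\dots,\alpha_n)$, and a supremum over the empty set is $0$. Define $$\rho(\mathscr M,\mathscr A_\ell(p^\pm)):=\limsup_{n\to\infty}\rho_n,\qquad \hat\rho(\mathscr M,\mathscr A_\ell(p^\pm)):=\limsup_{n\to\infty}\hat\rho_n,\qquad \hat\rho^{(\mathrm{per})}(\mathscr M,\mathscr A_\ell(p^\pm)):=\limsup_{n\to\infty}\hat\rho_n^{(\mathrm{per})}.$$ Then $\rho(\mathscr M,\mathscr A_\ell(p^\pm))$ is finite, and $$\hat\rho^{(\mathrm{per})}(\mathscr M,\mathscr A_\ell(p^\pm))=\rho(\mathscr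 M,\mathscr A_\ell(p^\pm)),$$ and consequently the Berger–Wang type equality $$\hat\rho(\mathscr M,\mathscr A_\ell(p^\pm))=\rho(\mathscr M,\mathscr A_\ell(p^\pm))$$ holds as well. -/

import Mathlib

open Filter
open scoped ENNReal

noncomputable section

namespace ConstrainedJSR

/-- The number of occurrences of the symbol `i` in the finite sequence `α`. -/
def occ {r n : ℕ} (α : Fin n → Fin r) (i : Fin r) : ℕ :=
  (Finset.univ.filter fun k => α k = i).card

/-- The sequences of length `l` in which the relative frequency of every symbol `i` lies
between `pm i` and `pp i`. -/
def blocks {r : ℕ} (l : ℕ) (pm pp : Fin r → ℝ) : Set (Fin l → Fin r) :=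
  {α | ∀ i, pm i ≤ (occ α i : ℝ) / (l : ℝ) ∧ (occ α i : ℝ) / (l : ℝ) ≤ pp i}

/-- The infinite sequences all of whose blocks of `l` consecutive symbols satisfy the frequency
constraints. -/
def seqs {r : ℕ} (l : ℕ) (pm pp : Fin r → ℝ) : Set (ℕ → Fin r) :=
  {β | ∀ m : ℕ, (fun k : Fin l => β (m + k)) ∈ blocks l pm pp}

/-- The admissible sequences of length `n`: the initial intervals of the sequences in `seqs`. -/
def admissible {r : ℕ} (l : ℕ) (pm pp : Fin r → ℝ) (n : ℕ) : Set (Fin n → Fin r) :=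
  {α | ∃ β ∈ seqs l pm pp, ∀ k : Fin n, β k = α k}

/-- The periodically extendable admissible sequences of length `n`: those which extend to the
right to an `n`-periodic sequence in `seqs`. -/
def perAdmissible {r : ℕ} (l : ℕ) (pm pp : Fin r → ℝ) (n : ℕ) : Set (Fin n → Fin r) :=
  {α | α ∈ admissible l pm pp n ∧
    ∃ β ∈ seqs l pm pp, Function.Periodic β n ∧ ∀ k : Fin n, β k = α k}

variable {𝕂 : Type*} [RCLike 𝕂] {d r : ℕ}

/-- The product `M (α (n-1)) * ⋯ * M (α 1) * M (α 0)`. -/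
def matProd (M : Fin r → Matrix (Fin d) (Fin d) 𝕂) {n : ℕ} (α : Fin n → Fin r) :
    Matrix (Fin d) (Fin d) 𝕂 :=
  (List.ofFn fun k => M (α k)).reverse.prod

/-- The spectral radius of a real or complex matrix: the largest modulus of its complex
eigenvalues (also if the matrix is real). -/
def specRad (A : Matrix (Fin d) (Fin d) 𝕂) : ℝ≥0∞ :=
  spectralRadius ℂ (A.map (RCLike.map 𝕂 ℂ))

/-- The supremum of `‖M_{α_n} ⋯ M_{α_1}‖ ^ (1/n)` over the admissible sequences of length `n`;
it is `0` if there are none. -/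
def jointRadN (N : AlgebraNorm 𝕂 (Matrix (Fin d) (Fin d) 𝕂))
    (M : Fin r → Matrix (Fin d) (Fin d) 𝕂) (l : ℕ) (pm pp : Fin r → ℝ) (n : ℕ) : ℝ≥0∞ :=
  ⨆ α ∈ admissible l pm pp n, ENNReal.ofReal (N (matProd M α)) ^ (1 / (n : ℝ))

/-- The constrained joint spectral radius. -/
def jointRad (N : AlgebraNorm 𝕂 (Matrix (Fin d) (Fin d) 𝕂))
    (M : Fin r → Matrix (Fin d) (Fin d) 𝕂) (l : ℕ) (pm pp : Fin r → ℝ) : ℝ≥0∞ :=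
  limsup (fun n : ℕ => jointRadN N M l pm pp n) atTop

/-- The supremum of `ρ(M_{α_n} ⋯ M_{α_1}) ^ (1/n)` over the admissible sequences of length `n`;
it is `0` if there are none. -/
def genRadN (M : Fin r → Matrix (Fin d) (Fin d) 𝕂) (l : ℕ) (pm pp : Fin r → ℝ) (n : ℕ) :
    ℝ≥0∞ :=
  ⨆ α ∈ admissible l pm pp n, specRad (matProd M α) ^ (1 / (n : ℝ))

/-- The constrained generalized spectral radius. -/
def genRad (M : Fin r → Matrix (Fin d) (Fin d) 𝕂) (l : ℕ) (pm pp : Fin r → ℝ) : ℝ≥0∞ :=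
  limsup (fun n : ℕ => genRadN M l pm pp n) atTop

/-- The supremum of `ρ(M_{α_n} ⋯ M_{α_1}) ^ (1/n)` over the periodically extendable admissible
sequences of length `n`; it is `0` if there are none. -/
def perRadN (M : Fin r → Matrix (Fin d) (Fin d) 𝕂) (l : ℕ) (pm pp : Fin r → ℝ) (n : ℕ) :
    ℝ≥0∞ :=
  ⨆ α ∈ perAdmissible l pm pp n, specRad (matProd M α) ^ (1 / (n : ℝ))

/-- The constrained periodic generalized spectral radius. -/
def perRad (M : Fin r → Matrix (Fin d) (Fin d) 𝕂) (l : ℕ) (pm pp : Fin r → ℝ) : ℝ≥0∞ :=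
  limsup (fun n : ℕ => perRadN M l pm pp n) atTop

end ConstrainedJSR

end

/-! Suppose that the eigenvalues of every product of `n` members of a family of endomorphisms of `V`
are bounded by `c ^ n`. If `V` is irreducible, then the products span `End V` by Burnside's theorem,
so a matrix coefficient `φ (w v)` of a product `w` is controlled by the traces of the products
`w * u` for finitely many `u`, hence is `O(c ^ n)`. For `φ ≠ 0` the supremum of `c⁻ⁿ |φ (w v)|` over
all words `w` of arbitrary length `n` is then a seminorm which each member of the family expands at
most by the factor `c`; its kernel is invariant, so it is a norm. If `V` has an invariant subspace
`W`, such norms on `W` and `V ⧸ W` combine to one on `V`, at the price of an arbitrarily small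
increase of `c`.

For products along the paths of a finite graph only those along closed paths are known to satisfy
the eigenvalue bound. The endomorphisms `graphLift` of `S → V` vanish on the words that are not
paths, so that the nonzero eigenvalues of their products come from closed paths and the
unconstrained argument applies. The sequences with prescribed blocks of length `l + 1` are the paths
of the overlap graph of these blocks, whose closed paths are the periodic sequences. Matrices are
turned into endomorphisms by left multiplication, which does not enlarge the spectrum. -/

open scoped NNReal

namespace ConstrainedJSR

theorem exists_seminorm_le_mul {𝕜 E : Type*} [NontriviallyNormedField 𝕜] [CompleteSpace 𝕜]
    [AddCommGroup E] [Module 𝕜 E] [FiniteDimensional 𝕜 E] {N : Seminorm 𝕜 E}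
    (hN : ∀ x, N x = 0 → x = 0) (Q : Seminorm 𝕜 E) : ∃ C : ℝ≥0, ∀ x, Q x ≤ C * N x := by
  let : Norm E := ⟨N⟩
  have core : NormedSpace.Core 𝕜 E :=
    { norm_nonneg := apply_nonneg N
      norm_smul := map_smul_eq_mul N
      norm_triangle := map_add_le_add N
      norm_eq_zero_iff := fun x => ⟨hN x, fun h => h ▸ map_zero N⟩ }
  let : NormedAddCommGroup E := NormedAddCommGroup.ofCore core
  let : NormedSpace 𝕜 E := NormedSpace.ofCore core
  let b := Module.finBasis 𝕜 E
  let coord : E →L[𝕜] Fin (Module.finrank 𝕜 E) → 𝕜 := b.equivFun.toContinuousLinearEquiv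
  have hcoord (x : E) (i) : ‖b.repr x i‖ ≤ ‖coord‖₊ * N x :=
    (norm_le_pi_norm (coord x) i).trans (coord.le_opNorm x)
  refine ⟨‖coord‖₊ * ∑ i, (Q (b i)).toNNReal, fun x => ?_⟩
  calc Q x = Q (∑ i, b.repr x i • b i) := by rw [b.sum_repr]
    _ ≤ ∑ i, Q (b.repr x i • b i) :=
        Finset.le_sum_of_subadditive Q (map_zero Q).le (map_add_le_add Q) _ _
    _ ≤ ∑ i, ‖coord‖₊ * N x * Q (b i) := by
        gcongr with i
        rw [map_smul_eq_mul]
        gcongr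
        exact hcoord x i
    _ = (‖coord‖₊ * ∑ i, (Q (b i)).toNNReal : ℝ≥0) * N x := by
        push_cast [Real.coe_toNNReal _ (apply_nonneg Q _)]
        rw [← Finset.mul_sum]
        ring

section Intertwining

variable {ι K V W : Type*} [Field K] [AddCommGroup V] [Module K V] [AddCommGroup W] [Module K W]

theorem comp_list_prod_eq_of_intertwines {f : ι → Module.End K V} {f' : ι → Module.End K W}
    {g : V →ₗ[K] W} (h : ∀ i, g ∘ₗ f i = f' i ∘ₗ g) (w : List ι) :
    g ∘ₗ (w.map f).prod = (w.map f').prod ∘ₗ g := by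
  induction w with
  | nil => rfl
  | cons i w ih =>
    simp only [List.map_cons, List.prod_cons, Module.End.mul_eq_comp]
    rw [← LinearMap.comp_assoc, h, LinearMap.comp_assoc, ih, LinearMap.comp_assoc]

theorem hasEigenvalue_of_injective {a : Module.End K V} {b : Module.End K W} {g : V →ₗ[K] W}
    (hg : Function.Injective g) (h : g ∘ₗ a = b ∘ₗ g) {z : K} (hz : a.HasEigenvalue z) :
    b.HasEigenvalue z := by
  obtain ⟨v, hv⟩ := hz.exists_hasEigenvector
  refine Module.End.hasEigenvalue_of_hasEigenvector (x := g v)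
    ⟨Module.End.mem_eigenspace_iff.2 ?_, (map_ne_zero_iff g hg).2 hv.2⟩
  rw [← LinearMap.comp_apply, ← h, LinearMap.comp_apply, hv.apply_eq_smul, map_smul]

theorem hasEigenvalue_of_surjective [FiniteDimensional K V] {a : Module.End K V}
    {b : Module.End K W} {g : V →ₗ[K] W} (hg : Function.Surjective g) (h : g ∘ₗ a = b ∘ₗ g)
    {z : K} (hz : b.HasEigenvalue z) : a.HasEigenvalue z := by
  have : FiniteDimensional K W := .of_surjective g hg
  rw [Module.End.hasEigenvalue_iff, Module.End.eigenspace_def, ne_eq, LinearMap.ker_eq_bot,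
    LinearMap.injective_iff_surjective] at hz ⊢
  contrapose! hz
  have hsub : (b - algebraMap K _ z) ∘ₗ g = g ∘ₗ (a - algebraMap K _ z) := by
    rw [LinearMap.sub_comp, LinearMap.comp_sub, h]
    ext
    simp
  have hsurj : Function.Surjective ((b - algebraMap K _ z) ∘ₗ g) := by
    rw [hsub]
    exact hg.comp hz
  exact .of_comp hsurj

end Intertwining

section Irreducible

variable {ι K V : Type*} [Field K] [AddCommGroup V] [Module K V]

/-- A family of endomorphisms is irreducible if its only common invariant subspaces are the
trivial ones. The zero space counts as irreducible. -/
def IsIrreducible (f : ι → Module.End K V) : Prop :=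
  ∀ W : Submodule K V, (∀ i, W ∈ (f i).invtSubmodule) → W = ⊥ ∨ W = ⊤

theorem IsIrreducible.isSimpleModule_adjoin [Nontrivial V] {f : ι → Module.End K V}
    (hf : IsIrreducible f) : IsSimpleModule (Algebra.adjoin K (Set.range f)) V := by
  rw [isSimpleModule_iff]
  refine { exists_pair_ne := ⟨⊥, ⊤, bot_ne_top⟩, eq_bot_or_eq_top := fun U => ?_ }
  have hU (i) : U.restrictScalars K ∈ (f i).invtSubmodule := fun _ hv =>
    U.smul_mem ⟨f i, Algebra.subset_adjoin ⟨i, rfl⟩⟩ hv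
  simpa using hf (U.restrictScalars K) hU

theorem subalgebra_eq_top_of_isSimpleModule [IsAlgClosed K] [FiniteDimensional K V]
    (A : Subalgebra K (Module.End K V)) [IsSimpleModule A V] : A = ⊤ := by
  have hschur := IsSimpleModule.algebraMap_end_bijective_of_isAlgClosed (A := A) (V := V) K
  have : Module.Finite (Module.End A V) V := .of_restrictScalars_finite K _ _
  refine Algebra.eq_top_iff.2 fun T => ?_
  let T' : Module.End (Module.End A V) V :=
    { toFun := T
      map_add' := map_add T
      map_smul' := fun s v => by
        obtain ⟨z, rfl⟩ := hschur.2 s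
        simp }
  obtain ⟨a, ha⟩ := Module.Finite.toModuleEnd_moduleEnd_surjective (R := A) (M := V) T'
  have haT : (a : Module.End K V) = T := LinearMap.ext fun v => congr($ha v)
  exact haT ▸ a.2

theorem IsIrreducible.span_list_prod_eq_top [IsAlgClosed K] [FiniteDimensional K V] [Nontrivial V]
    {f : ι → Module.End K V} (hf : IsIrreducible f) :
    Submodule.span K (Set.range fun w : List ι => (w.map f).prod) = ⊤ := by
  have := hf.isSimpleModule_adjoin
  have hrange : Set.range (fun w : List ι => (w.map f).prod) =
      Submonoid.closure (Set.range f) := by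
    rw [← FreeMonoid.mrange_lift, MonoidHom.coe_mrange]
    exact congrArg Set.range (funext fun w => (FreeMonoid.lift_ofList f w).symm)
  rw [hrange, ← Algebra.adjoin_eq_span, subalgebra_eq_top_of_isSimpleModule (Algebra.adjoin K _),
    Algebra.top_toSubmodule]

end Irreducible

section Family

variable {ι 𝕜 V : Type*} [NontriviallyNormedField 𝕜] [AddCommGroup V] [Module 𝕜 V]

/-- Some norm on the space is expanded at most by the factor `c` by each member of the family. The
space carries no topology, and the norm is encoded as a definite seminorm. -/
def HasAdaptedNorm (f : ι → Module.End 𝕜 V) (c : ℝ≥0) : Prop :=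
  ∃ N : Seminorm 𝕜 V, (∀ v, N v = 0 → v = 0) ∧ ∀ i v, N (f i v) ≤ c * N v

/-- The eigenvalues of every product of `n` members of the family have norm at most `c ^ n`; this
is the bound that the generalized spectral radius provides. -/
def EigenvalueBound (f : ι → Module.End 𝕜 V) (c : ℝ≥0) : Prop :=
  ∀ (w : List ι) (z : 𝕜), (w.map f).prod.HasEigenvalue z → ‖z‖ ≤ c ^ w.length

theorem EigenvalueBound.mono {f : ι → Module.End 𝕜 V} {c c' : ℝ≥0} (hf : EigenvalueBound f c)
    (h : c ≤ c') : EigenvalueBound f c' :=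
  fun w z hz => (hf w z hz).trans (by gcongr)

theorem EigenvalueBound.restrict {f : ι → Module.End 𝕜 V} {c : ℝ≥0} (hf : EigenvalueBound f c)
    {W : Submodule 𝕜 V} (hW : ∀ i, W ∈ (f i).invtSubmodule) :
    EigenvalueBound (fun i => (f i).restrict (hW i)) c := fun w z hz =>
  hf w z (hasEigenvalue_of_injective W.subtype_injective
    (comp_list_prod_eq_of_intertwines (fun _ => LinearMap.subtype_comp_restrict _) w) hz)

theorem EigenvalueBound.mapQ [FiniteDimensional 𝕜 V] {f : ι → Module.End 𝕜 V} {c : ℝ≥0}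
    (hf : EigenvalueBound f c) {W : Submodule 𝕜 V} (hW : ∀ i, W ∈ (f i).invtSubmodule) :
    EigenvalueBound (fun i => W.mapQ W (f i) (hW i)) c := fun w z hz =>
  hf w z (hasEigenvalue_of_surjective W.mkQ_surjective
    (comp_list_prod_eq_of_intertwines (fun i => (W.mapQ_mkQ W (f i)).symm) w) hz)

theorem EigenvalueBound.norm_trace_list_prod_le [IsAlgClosed 𝕜] [FiniteDimensional 𝕜 V]
    {f : ι → Module.End 𝕜 V} {c : ℝ≥0} (hf : EigenvalueBound f c) (w : List ι) :
    ‖LinearMap.trace 𝕜 V (w.map f).prod‖ ≤ Module.finrank 𝕜 V * c ^ w.length := by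
  set roots := (w.map f).prod.charpoly.roots with hroots
  have hle : ∀ x ∈ roots.map (‖·‖), x ≤ c ^ w.length := by
    intro x hx
    obtain ⟨z, hz, rfl⟩ := Multiset.mem_map.1 hx
    exact hf w z ((Module.End.hasEigenvalue_iff_isRoot_charpoly _ _).2
      (Polynomial.isRoot_of_mem_roots hz))
  calc ‖LinearMap.trace 𝕜 V (w.map f).prod‖ = ‖roots.sum‖ := by
        rw [Module.End.trace_eq_sum_roots_charpoly_of_splits (IsAlgClosed.splits _)]
    _ ≤ (roots.map (‖·‖)).sum :=
        Multiset.le_sum_of_subadditive (‖·‖) norm_zero.le norm_add_le _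
    _ ≤ (roots.map (‖·‖)).card • (c : ℝ) ^ w.length := Multiset.sum_le_card_nsmul _ _ hle
    _ = Module.finrank 𝕜 V * c ^ w.length := by
        rw [Multiset.card_map, hroots, IsAlgClosed.card_roots_eq_natDegree,
          LinearMap.charpoly_natDegree, nsmul_eq_mul]

theorem exists_norm_trace_list_prod_mul_le [IsAlgClosed 𝕜] [FiniteDimensional 𝕜 V] [Nontrivial V]
    {f : ι → Module.End 𝕜 V} {c : ℝ≥0} (hc : EigenvalueBound f c) (hf : IsIrreducible f)
    (T : Module.End 𝕜 V) : ∃ K : ℝ, ∀ w : List ι,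
      ‖LinearMap.trace 𝕜 V ((w.map f).prod * T)‖ ≤ K * c ^ w.length := by
  have hT : T ∈ Submodule.span 𝕜 (Set.range fun w : List ι => (w.map f).prod) :=
    hf.span_list_prod_eq_top ▸ Submodule.mem_top
  induction hT using Submodule.span_induction with
  | mem T hT =>
    obtain ⟨u, rfl⟩ := hT
    refine ⟨Module.finrank 𝕜 V * c ^ u.length, fun w => ?_⟩
    calc ‖LinearMap.trace 𝕜 V ((w.map f).prod * (u.map f).prod)‖
        = ‖LinearMap.trace 𝕜 V ((w ++ u).map f).prod‖ := by rw [List.map_append, List.prod_append]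
      _ ≤ Module.finrank 𝕜 V * c ^ (w ++ u).length := hc.norm_trace_list_prod_le _
      _ = Module.finrank 𝕜 V * c ^ u.length * c ^ w.length := by
          rw [List.length_append, pow_add]
          ring
  | zero => exact ⟨0, by simp⟩
  | add S T _ _ hS hT =>
    obtain ⟨K, hK⟩ := hS
    obtain ⟨L, hL⟩ := hT
    refine ⟨K + L, fun w => ?_⟩
    rw [mul_add, map_add, add_mul]
    exact norm_add_le_of_le (hK w) (hL w)
  | smul z T _ hT =>
    obtain ⟨K, hK⟩ := hT
    refine ⟨‖z‖ * K, fun w => ?_⟩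
    rw [mul_smul_comm, map_smul, norm_smul, mul_assoc]
    gcongr
    exact hK w

theorem exists_norm_dual_list_prod_le [IsAlgClosed 𝕜] [FiniteDimensional 𝕜 V] [Nontrivial V]
    {f : ι → Module.End 𝕜 V} {c : ℝ≥0} (hc : EigenvalueBound f c) (hf : IsIrreducible f)
    (φ : Module.Dual 𝕜 V) (v : V) : ∃ K : ℝ, ∀ w : List ι,
      ‖φ ((w.map f).prod v)‖ ≤ K * c ^ w.length := by
  obtain ⟨K, hK⟩ := exists_norm_trace_list_prod_mul_le hc hf (φ.smulRight v)
  refine ⟨K, fun w => ?_⟩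
  have hcomp : (w.map f).prod * φ.smulRight v = φ.smulRight ((w.map f).prod v) := by
    ext
    simp
  rw [← LinearMap.trace_smulRight, ← hcomp]
  exact hK w

theorem exists_seminorm_ge_of_forall_list_prod_le {f : ι → Module.End 𝕜 V} {c : ℝ≥0} (hc : c ≠ 0)
    (P : Seminorm 𝕜 V) (hP : ∀ v, ∃ K : ℝ, ∀ w : List ι, P ((w.map f).prod v) ≤ K * c ^ w.length) :
    ∃ N : Seminorm 𝕜 V, P ≤ N ∧ ∀ i v, N (f i v) ≤ c * N v := by
  have hpos (n : ℕ) : 0 < (c : ℝ) ^ n := by positivity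
  let p (w : List ι) : Seminorm 𝕜 V := (c ^ w.length)⁻¹ • P.comp (w.map f).prod
  have hp (w : List ι) (v : V) : p w v = P ((w.map f).prod v) / c ^ w.length := by
    simp [p, NNReal.smul_def, div_eq_inv_mul]
  have hbdd : BddAbove (Set.range p) := by
    refine Seminorm.bddAbove_range_iff.2 fun v => ?_
    obtain ⟨K, hK⟩ := hP v
    refine ⟨K, Set.forall_mem_range.2 fun w => ?_⟩
    rw [hp, div_le_iff₀ (hpos _)]
    exact hK w
  refine ⟨⨆ w, p w, fun v => ?_, fun i v => ?_⟩
  · have := le_ciSup hbdd [] v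
    rwa [hp, List.map_nil, List.prod_nil, List.length_nil, pow_zero, div_one] at this
  · rw [Seminorm.iSup_apply hbdd]
    refine ciSup_le fun w => ?_
    have := le_ciSup hbdd (w ++ [i]) v
    rw [hp, List.map_append, List.prod_append, List.length_append, pow_add, List.map_singleton,
      List.prod_singleton, List.length_singleton, pow_one, ← div_div, div_le_iff₀' (by positivity)]
      at this
    rw [hp]
    exact this

theorem IsIrreducible.seminorm_definite {f : ι → Module.End 𝕜 V} (hf : IsIrreducible f)
    {c : ℝ≥0} {N : Seminorm 𝕜 V} (hN : ∀ i v, N (f i v) ≤ c * N v) (hN₀ : N ≠ 0) (v : V)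
    (hv : N v = 0) : v = 0 := by
  let W : Submodule 𝕜 V :=
    { carrier := {v | N v = 0}
      zero_mem' := map_zero N
      add_mem' := fun {x y} (hx : N x = 0) (hy : N y = 0) =>
        ((map_add_le_add N x y).trans_eq (by rw [hx, hy, add_zero])).antisymm (apply_nonneg N _)
      smul_mem' := fun z x (hx : N x = 0) => by simp [map_smul_eq_mul, hx] }
  have hW (i) : W ∈ (f i).invtSubmodule := fun v (hv : N v = 0) =>
    ((hN i v).trans_eq (by rw [hv, mul_zero])).antisymm (apply_nonneg N _)
  rcases hf W hW with h | h
  · exact (Submodule.mem_bot 𝕜).1 (h ▸ (show v ∈ W from hv))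
  · exact absurd (Seminorm.ext fun x => show N x = 0 from (h ▸ Submodule.mem_top : x ∈ W)) hN₀

theorem HasAdaptedNorm.of_isIrreducible [IsAlgClosed 𝕜] [FiniteDimensional 𝕜 V] [Nontrivial V]
    {f : ι → Module.End 𝕜 V} {c : ℝ≥0} (hc : c ≠ 0) (hfc : EigenvalueBound f c)
    (hf : IsIrreducible f) : HasAdaptedNorm f c := by
  obtain ⟨v, hv⟩ := exists_ne (0 : V)
  obtain ⟨φ, hφ⟩ := Module.Projective.exists_dual_ne_zero 𝕜 hv
  obtain ⟨N, hPN, hN⟩ := exists_seminorm_ge_of_forall_list_prod_le hc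
    ((normSeminorm 𝕜 𝕜).comp φ) (exists_norm_dual_list_prod_le hfc hf φ)
  have hN₀ : N ≠ 0 := by
    rintro rfl
    exact hφ (norm_le_zero_iff.1 (hPN v))
  exact ⟨N, hf.seminorm_definite hN hN₀, hN⟩

theorem exists_seminorm_apply_le_add [CompleteSpace 𝕜] [FiniteDimensional 𝕜 V]
    {f : Module.End 𝕜 V} {W : Submodule 𝕜 V} {c : ℝ≥0}
    {P : Seminorm 𝕜 V} (hP : ∀ v ∈ W, P (f v) ≤ c * P v)
    {Q : Seminorm 𝕜 (V ⧸ W)} (hQ : ∀ x, Q x = 0 → x = 0) :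
    ∃ K : ℝ≥0, ∀ v, P (f v) ≤ c * P v + K * Q (W.mkQ v) := by
  obtain ⟨σ, hσ⟩ := W.mkQ.exists_rightInverse_of_surjective W.range_mkQ
  have hσ' (q : V ⧸ W) : W.mkQ (σ q) = q := LinearMap.congr_fun hσ q
  obtain ⟨K, hK⟩ := exists_seminorm_le_mul hQ (c • P.comp σ + P.comp (f ∘ₗ σ))
  refine ⟨K, fun v => ?_⟩
  set q := W.mkQ v
  have hmem : v - σ q ∈ W := by
    rw [← Submodule.Quotient.mk_eq_zero, ← W.mkQ_apply, map_sub, hσ', sub_self]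
  calc P (f v) = P (f (v - σ q) + f (σ q)) := by rw [← map_add, sub_add_cancel]
    _ ≤ P (f (v - σ q)) + P (f (σ q)) := map_add_le_add P _ _
    _ ≤ c * P (v - σ q) + P (f (σ q)) := by gcongr; exact hP _ hmem
    _ ≤ c * (P v + P (σ q)) + P (f (σ q)) := by gcongr; exact map_sub_le_add P _ _
    _ = c * P v + (c • P.comp σ + P.comp (f ∘ₗ σ)) q := by
        simp only [add_apply, smul_apply, Seminorm.comp_apply,
          LinearMap.comp_apply, NNReal.smul_def, smul_eq_mul]
        ring
    _ ≤ c * P v + K * Q q := by gcongr; exact hK q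

theorem HasAdaptedNorm.of_invtSubmodule [Finite ι] [CompleteSpace 𝕜] [FiniteDimensional 𝕜 V]
    {f : ι → Module.End 𝕜 V} {W : Submodule 𝕜 V} (hW : ∀ i, W ∈ (f i).invtSubmodule) {c c' : ℝ≥0}
    (hcc' : c < c') (hsub : HasAdaptedNorm (fun i => (f i).restrict (hW i)) c)
    (hquot : HasAdaptedNorm (fun i => W.mapQ W (f i) (hW i)) c) : HasAdaptedNorm f c' := by
  obtain ⟨P, hP, hPf⟩ := hsub
  obtain ⟨Q, hQ, hQf⟩ := hquot
  obtain ⟨π, hπ⟩ := W.subtype.exists_leftInverse_of_injective W.ker_subtype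
  have hπ' (x : W) : π x = x := LinearMap.congr_fun hπ x
  have hext (i) (v) (hv : v ∈ W) : P.comp π (f i v) ≤ c * P.comp π v :=
    calc P (π (f i v)) = P ((f i).restrict (hW i) ⟨v, hv⟩) := congrArg P (hπ' ⟨f i v, hW i hv⟩)
      _ ≤ c * P ⟨v, hv⟩ := hPf i _
      _ = c * P (π v) := by rw [← hπ' ⟨v, hv⟩]
  choose K hK using fun i => exists_seminorm_apply_le_add (hext i) hQ
  obtain ⟨L, hL⟩ := Finite.exists_le K
  obtain ⟨ε, hε, hεL⟩ := exists_pos_mul_lt (tsub_pos_of_lt hcc') L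
  -- a small weight on the first summand makes the off-diagonal term negligible
  refine ⟨ε • P.comp π + Q.comp W.mkQ, fun v hv => ?_, fun i v => ?_⟩
  · simp only [add_apply, smul_apply, NNReal.smul_def, smul_eq_mul] at hv
    obtain ⟨hPv, hQv⟩ := (add_eq_zero_iff_of_nonneg (by positivity) (apply_nonneg _ v)).1 hv
    have hvW : v ∈ W := (Submodule.Quotient.mk_eq_zero W).1 (hQ _ hQv)
    have hPv' := hP _ ((mul_eq_zero.1 hPv).resolve_left (by positivity))
    rw [hπ' ⟨v, hvW⟩] at hPv'
    exact congrArg Subtype.val hPv'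
  · simp only [add_apply, smul_apply, NNReal.smul_def, smul_eq_mul]
    have hεK : (ε : ℝ) * K i ≤ c' - c := by
      rw [← NNReal.coe_sub hcc'.le, mul_comm]
      exact_mod_cast (mul_le_mul_left (hL i) ε).trans hεL.le
    calc ε * P.comp π (f i v) + Q (W.mkQ (f i v))
        ≤ ε * (c * P.comp π v + K i * Q (W.mkQ v)) + c * Q (W.mkQ v) := by
          gcongr
          exacts [hK i v, hQf i (W.mkQ v)]
      _ = c * (ε * P.comp π v) + (ε * K i) * Q (W.mkQ v) + c * Q (W.mkQ v) := by ring
      _ ≤ c' * (ε * P.comp π v) + (c' - c) * Q (W.mkQ v) + c * Q (W.mkQ v) := by gcongr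
      _ = c' * (ε * P.comp π v + Q.comp W.mkQ v) := by
          rw [Seminorm.comp_apply Q]
          ring

theorem hasAdaptedNorm_of_eigenvalueBound [Finite ι] [CompleteSpace 𝕜] [IsAlgClosed 𝕜]
    [FiniteDimensional 𝕜 V] {f : ι → Module.End 𝕜 V} {c c' : ℝ≥0} (hf : EigenvalueBound f c)
    (hcc' : c < c') : HasAdaptedNorm f c' := by
  induction hn : Module.finrank 𝕜 V using Nat.strong_induction_on generalizing V c' with
  | _ n ih =>
    rcases subsingleton_or_nontrivial V with hV | hV
    · exact ⟨0, fun v _ => Subsingleton.elim _ _, fun i v => by simp⟩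
    by_cases hirr : IsIrreducible f
    · exact .of_isIrreducible hcc'.ne_bot (hf.mono hcc'.le) hirr
    · simp only [IsIrreducible, not_forall, not_or] at hirr
      obtain ⟨W, hW, hbot, htop⟩ := hirr
      obtain ⟨b, hcb, hbc'⟩ := exists_between hcc'
      have hpos : 0 < Module.finrank 𝕜 W := by
        have := Submodule.nontrivial_iff_ne_bot.2 hbot
        exact Module.finrank_pos
      have hlt : Module.finrank 𝕜 W < n := hn ▸ Submodule.finrank_lt htop
      have hsum := W.finrank_quotient_add_finrank
      exact .of_invtSubmodule hW hbc' (ih _ hlt (hf.restrict hW) hcb rfl)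
        (ih _ (by lia) (hf.mapQ hW) hcb rfl)

end Family

section Graph

variable {S K V : Type*} [Field K] [AddCommGroup V] [Module K V]

open Classical in
/-- The graph with edge relation `R` and an endomorphism `A t` of `V` attached to each vertex `t`,
encoded as a family of endomorphisms of `S → V`: the member at `t` applies `A t` to the component
at `t`, copies the result to all successors of `t` and forgets the other components. A product of
members is thus nonzero only along paths. -/
noncomputable def graphLift (R : S → S → Prop) (A : S → Module.End K V) (t : S) :
    Module.End K (S → V) :=
  LinearMap.pi fun t' => if R t t' then A t ∘ₗ LinearMap.proj t else 0

open Classical in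
theorem graphLift_list_prod_apply (R : S → S → Prop) (A : S → Module.End K V) (w : List S)
    (x : S → V) (t : S) :
    (w.map (graphLift R A)).prod x t = if (t :: w).IsChain (flip R) then
      (w.map A).prod (x ((t :: w).getLast (List.cons_ne_nil t w))) else 0 := by
  induction w generalizing t with
  | nil => simp
  | cons a w ih =>
    simp only [List.map_cons, List.prod_cons, Module.End.mul_apply, List.isChain_cons_cons, ite_and]
    by_cases h : R a t <;> by_cases hw : (a :: w).IsChain (flip R) <;>
      simp [graphLift, flip, h, hw, ih]

theorem isChain_of_hasEigenvalue_graphLift {R : S → S → Prop} {A : S → Module.End K V} {w : List S}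
    (hw : w ≠ []) {z : K} (hz₀ : z ≠ 0) (hz : (w.map (graphLift R A)).prod.HasEigenvalue z) :
    (w.getLast hw :: w).IsChain (flip R) ∧ (w.map A).prod.HasEigenvalue z := by
  classical
  obtain ⟨x, hx⟩ := hz.exists_hasEigenvector
  have hxt (t : S) :
      z • x t = if (t :: w).IsChain (flip R) then (w.map A).prod (x (w.getLast hw)) else 0 := by
    rw [← List.getLast_cons hw, ← graphLift_list_prod_apply, hx.apply_eq_smul, Pi.smul_apply]
  have hx₀ : x (w.getLast hw) ≠ 0 := fun h₀ =>
    hx.2 (funext fun t => (smul_eq_zero.1 ((hxt t).trans (by simp [h₀]))).resolve_left hz₀)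
  have hchain : (w.getLast hw :: w).IsChain (flip R) := by
    by_contra h
    exact smul_ne_zero hz₀ hx₀ ((hxt _).trans (if_neg h))
  refine ⟨hchain, Module.End.hasEigenvalue_of_hasEigenvector
    ⟨Module.End.mem_eigenspace_iff.2 ?_, hx₀⟩⟩
  rw [hxt, if_pos hchain]

end Graph

section GraphNorm

variable {ι S 𝕜 V : Type*} [NontriviallyNormedField 𝕜] [AddCommGroup V] [Module 𝕜 V]

theorem seminorm_list_prod_le {f : ι → Module.End 𝕜 V} {c : ℝ≥0} {N : Seminorm 𝕜 V}
    (hN : ∀ i v, N (f i v) ≤ c * N v) (w : List ι) (v : V) :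
    N ((w.map f).prod v) ≤ c ^ w.length * N v := by
  induction w with
  | nil => simp
  | cons i w ih =>
    calc N (((i :: w).map f).prod v) ≤ c * N ((w.map f).prod v) := hN i _
      _ ≤ c * (c ^ w.length * N v) := by gcongr
      _ = c ^ (i :: w).length * N v := by rw [List.length_cons, pow_succ', mul_assoc]

theorem eigenvalueBound_graphLift {R : S → S → Prop} {A : S → Module.End 𝕜 V} {c : ℝ≥0}
    (hA : ∀ (w : List S) (hw : w ≠ []), (w.getLast hw :: w).IsChain (flip R) →
      ∀ z, (w.map A).prod.HasEigenvalue z → ‖z‖ ≤ c ^ w.length) :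
    EigenvalueBound (graphLift R A) c := by
  intro w z hz
  rcases eq_or_ne z 0 with rfl | hz₀
  · simp
  rcases eq_or_ne w [] with rfl | hw
  · obtain ⟨x, hx⟩ := hz.exists_hasEigenvector
    have hzx : (1 : 𝕜) • x = z • x := (one_smul 𝕜 x).trans hx.apply_eq_smul
    simp [← smul_left_injective 𝕜 hx.2 hzx]
  · obtain ⟨hchain, hzA⟩ := isChain_of_hasEigenvalue_graphLift hw hz₀ hz
    exact hA w hw hchain z hzA

theorem exists_seminorm_list_prod_le_of_isChain [Finite S] [CompleteSpace 𝕜] [IsAlgClosed 𝕜]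
    [FiniteDimensional 𝕜 V] {R : S → S → Prop} {A : S → Module.End 𝕜 V} {c c' : ℝ≥0} (hcc' : c < c')
    (hA : ∀ (w : List S) (hw : w ≠ []), (w.getLast hw :: w).IsChain (flip R) →
      ∀ z, (w.map A).prod.HasEigenvalue z → ‖z‖ ≤ c ^ w.length) (P : Seminorm 𝕜 V) (v : V) :
    ∃ C : ℝ≥0, ∀ t w, (t :: w).IsChain (flip R) → P ((w.map A).prod v) ≤ C * c' ^ w.length := by
  have := Fintype.ofFinite S
  obtain ⟨N, hN, hNf⟩ := hasAdaptedNorm_of_eigenvalueBound (eigenvalueBound_graphLift hA) hcc'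
  choose D hD using fun t : S => exists_seminorm_le_mul hN (P.comp (LinearMap.proj t))
  obtain ⟨L, hL⟩ := Finite.exists_le D
  let x : S → V := fun _ => v
  refine ⟨L * (N x).toNNReal, fun t w hw => ?_⟩
  calc P ((w.map A).prod v) = P ((w.map (graphLift R A)).prod x t) := by
        classical
        rw [graphLift_list_prod_apply, if_pos hw]
    _ ≤ D t * N ((w.map (graphLift R A)).prod x) := hD t _
    _ ≤ L * (c' ^ w.length * N x) := by
        gcongr
        exacts [hL t, seminorm_list_prod_le hNf w x]
    _ = (L * (N x).toNNReal : ℝ≥0) * c' ^ w.length := by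
        push_cast [Real.coe_toNNReal _ (apply_nonneg N _)]
        ring

end GraphNorm

section Sequence

variable {S T X Y : Type*} [Monoid X] [Monoid Y]

/-- The word formed by the first `n` symbols of a sequence, latest symbol first, the order in which
the factors of `M_{α_n} ⋯ M_{α_1}` are written. -/
def initialWord (s : ℕ → S) : ℕ → List S
  | 0 => []
  | n + 1 => s n :: initialWord s n

theorem initialWord_eq_reverse_ofFn (s : ℕ → S) (n : ℕ) :
    initialWord s n = (List.ofFn fun k : Fin n => s k).reverse := by
  induction n with
  | zero => rfl
  | succ n ih => rw [initialWord, ih, List.ofFn_succ_last, List.reverse_append]; rfl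

theorem length_initialWord (s : ℕ → S) (n : ℕ) : (initialWord s n).length = n := by
  simp [initialWord_eq_reverse_ofFn]

theorem isChain_initialWord {R : S → S → Prop} {s : ℕ → S} (hs : ∀ k, R (s k) (s (k + 1))) (n : ℕ) :
    (s n :: initialWord s n).IsChain (flip R) := by
  induction n with
  | zero => exact .singleton _
  | succ n ih => exact .cons_cons (hs n) ih

theorem exists_periodic_of_isChain {R : S → S → Prop} {w : List S} (hw : w ≠ [])
    (hchain : (w.getLast hw :: w).IsChain (flip R)) :
    ∃ s : ℕ → S, Function.Periodic s w.length ∧ (∀ k, R (s k) (s (k + 1))) ∧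
      initialWord s w.length = w := by
  have hpos : 0 < w.length := List.length_pos_iff.2 hw
  have hmod (k : ℕ) : k % w.length < w.reverse.length := by
    simpa using Nat.mod_lt k hpos
  refine ⟨fun k => w.reverse[k % w.length]'(hmod k), fun k => by simp, fun k => ?_, ?_⟩
  · have hchain' : (w.reverse ++ [w.getLast hw]).IsChain R := by
      rw [← List.reverse_cons, List.isChain_reverse]
      exact hchain
    have hstep := List.isChain_iff_getElem.1 hchain' (k % w.length) (by simpa using hmod k)
    rw [List.getElem_append_left (hmod k)] at hstep
    convert hstep using 1
    rcases (Nat.succ_le_of_lt (Nat.mod_lt k hpos)).lt_or_eq with hlt | heq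
    · have hsucc : (k + 1) % w.length = k % w.length + 1 := by
        rw [← Nat.mod_add_mod, Nat.mod_eq_of_lt hlt]
      simp only [hsucc]
      rw [List.getElem_append_left]
    · have hsucc : (k + 1) % w.length = 0 := by
        rw [← Nat.mod_add_mod]
        exact (congrArg (· % w.length) heq).trans (Nat.mod_self _)
      rw [List.getElem_concat_length (by simpa using heq)]
      simp [hsucc, List.getLast_eq_getElem]
  · rw [initialWord_eq_reverse_ofFn, List.reverse_eq_iff]
    apply List.ext_getElem <;> simp +contextual [Nat.mod_eq_of_lt]

/-- The product `A (s (n - 1)) * ⋯ * A (s 0)` along the sequence `s`. -/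
def seqProd (A : S → X) (s : ℕ → S) (n : ℕ) : X :=
  ((initialWord s n).map A).prod

theorem seqProd_succ (A : S → X) (s : ℕ → S) (n : ℕ) :
    seqProd A s (n + 1) = A (s n) * seqProd A s n :=
  List.prod_cons

theorem map_seqProd {F : Type*} [FunLike F X Y] [MonoidHomClass F X Y] (φ : F) (A : S → X)
    (s : ℕ → S) (n : ℕ) : φ (seqProd A s n) = seqProd (φ ∘ A) s n := by
  rw [seqProd, map_list_prod, List.map_map, seqProd]

theorem seqProd_comp (A : T → X) (g : S → T) (s : ℕ → S) (n : ℕ) :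
    seqProd (A ∘ g) s n = seqProd A (g ∘ s) n := by
  induction n with
  | zero => rfl
  | succ n ih => rw [seqProd_succ, seqProd_succ, ih, Function.comp_apply, Function.comp_apply]

theorem seqProd_add (A : S → X) (s : ℕ → S) (m n : ℕ) :
    seqProd A s (m + n) = seqProd A (fun k => s (m + k)) n * seqProd A s m := by
  induction n with
  | zero => exact (one_mul _).symm
  | succ n ih => rw [← add_assoc, seqProd_succ, ih, seqProd_succ, mul_assoc]

theorem seqProd_mul_of_periodic (A : S → X) {s : ℕ → S} {n : ℕ} (hs : Function.Periodic s n)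
    (k : ℕ) : seqProd A s (n * k) = seqProd A s n ^ k := by
  induction k with
  | zero => rw [pow_zero]; rfl
  | succ k ih =>
    have hshift : (fun j => s (n * k + j)) = s := funext fun j => by
      rw [add_comm, mul_comm]
      exact hs.nat_mul k j
    rw [Nat.mul_succ, seqProd_add, hshift, ih, pow_succ']

end Sequence

section Shift

/-- The infinite sequences all of whose blocks of `l` consecutive symbols belong to `B`. -/
def blockShift {S : Type*} {l : ℕ} (B : Set (Fin l → S)) : Set (ℕ → S) :=
  {β | ∀ m : ℕ, (fun k : Fin l => β (m + k)) ∈ B}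

theorem mem_blockShift_of_overlap {S : Type*} {l : ℕ} {B : Set (Fin (l + 1) → S)} {s : ℕ → B}
    (hs : ∀ k, ∀ i : Fin l, (s k).1 i.succ = (s (k + 1)).1 i.castSucc) :
    (fun k => (s k).1 0) ∈ blockShift B := by
  have hsymbol (i : Fin (l + 1)) (m : ℕ) : (s (m + i)).1 0 = (s m).1 i := by
    induction i using Fin.induction generalizing m with
    | zero => rfl
    | succ i ih =>
      calc (s (m + i.succ)).1 0 = (s (m + 1 + i.castSucc)).1 0 := by
            rw [Fin.val_succ, Fin.val_castSucc, add_right_comm, add_assoc]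
        _ = (s (m + 1)).1 i.castSucc := ih (m + 1)
        _ = (s m).1 i.succ := (hs m i).symm
  intro m
  simpa only [hsymbol] using (s m).2

variable {S 𝕜 𝔸 : Type*} [NontriviallyNormedField 𝕜] [CompleteSpace 𝕜] [IsAlgClosed 𝕜]
  [Ring 𝔸] [Algebra 𝕜 𝔸] [FiniteDimensional 𝕜 𝔸]

theorem exists_seminorm_seqProd_le [Finite S] {l : ℕ} {B : Set (Fin (l + 1) → S)} {A : S → 𝔸}
    {c c' : ℝ≥0} (hcc' : c < c')
    (hA : ∀ β ∈ blockShift B, ∀ n, 0 < n → Function.Periodic β n →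
      ∀ z ∈ spectrum 𝕜 (seqProd A β n), ‖z‖ ≤ c ^ n) (P : Seminorm 𝕜 𝔸) :
    ∃ C : ℝ≥0, ∀ β ∈ blockShift B, ∀ n, P (seqProd A β n) ≤ C * c' ^ n := by
  let firstSymbol (s : B) : S := s.1 0
  let R (s t : B) : Prop := ∀ i : Fin l, s.1 i.succ = t.1 i.castSucc
  let L : B → Module.End 𝕜 𝔸 := fun s => Algebra.lmul 𝕜 𝔸 (A (firstSymbol s))
  have hL (s : ℕ → B) (n : ℕ) :
      seqProd L s n = Algebra.lmul 𝕜 𝔸 (seqProd A (firstSymbol ∘ s) n) := by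
    rw [← seqProd_comp, map_seqProd]
    rfl
  have hclosed (w : List B) (hw : w ≠ []) (hchain : (w.getLast hw :: w).IsChain (flip R)) (z : 𝕜)
      (hz : (w.map L).prod.HasEigenvalue z) : ‖z‖ ≤ c ^ w.length := by
    obtain ⟨s, hper, hR, hsw⟩ := exists_periodic_of_isChain hw hchain
    refine hA _ (mem_blockShift_of_overlap hR) _ (List.length_pos_iff.2 hw)
      (hper.comp firstSymbol) z
      (AlgHom.spectrum_apply_subset (Algebra.lmul 𝕜 𝔸) _ (Module.End.HasEigenvalue.mem_spectrum ?_))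
    have hprod := hL s w.length
    rw [seqProd, hsw] at hprod
    exact hprod ▸ hz
  obtain ⟨C, hC⟩ := exists_seminorm_list_prod_le_of_isChain hcc' hclosed P 1
  refine ⟨C, fun β hβ n => ?_⟩
  let s (m : ℕ) : B := ⟨fun k => β (m + k), hβ m⟩
  have hR (m : ℕ) : R (s m) (s (m + 1)) := fun i => by
    simp [s, add_assoc, add_comm 1]
  have := hC _ _ (isChain_initialWord hR n)
  rw [← seqProd, hL, length_initialWord] at this
  simpa [s, firstSymbol, Function.comp_def] using this

end Shift

section GrowthRate

theorem limsup_rpow_one_div_mul_le (C : ℝ≥0) (u : ℕ → ℝ≥0∞) :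
    limsup (fun n : ℕ => (C : ℝ≥0∞) ^ (1 / (n : ℝ)) * u n) atTop ≤ limsup u atTop := by
  have htendsto : Tendsto (fun n : ℕ => ((C + 1 : ℝ≥0) : ℝ≥0∞) ^ (1 / (n : ℝ))) atTop (nhds 1) := by
    have h := (tendsto_const_nhds (x := C + 1)).nnrpow tendsto_one_div_atTop_nhds_zero_nat
      (Or.inl (by positivity))
    rw [NNReal.rpow_zero] at h
    exact (ENNReal.tendsto_coe.2 h).congr fun n => ENNReal.coe_rpow_of_ne_zero (by positivity) _
  have hlim := htendsto.limsup_eq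
  calc limsup (fun n : ℕ => (C : ℝ≥0∞) ^ (1 / (n : ℝ)) * u n) atTop
      ≤ limsup ((fun n : ℕ => ((C + 1 : ℝ≥0) : ℝ≥0∞) ^ (1 / (n : ℝ))) * u) atTop := by
        refine limsup_le_limsup (.of_forall fun n => ?_)
        change (C : ℝ≥0∞) ^ (1 / (n : ℝ)) * u n ≤ ((C + 1 : ℝ≥0) : ℝ≥0∞) ^ (1 / (n : ℝ)) * u n
        gcongr
        exact le_self_add
    _ ≤ limsup (fun n : ℕ => ((C + 1 : ℝ≥0) : ℝ≥0∞) ^ (1 / (n : ℝ))) atTop * limsup u atTop :=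
        ENNReal.limsup_mul_le' (.inl (hlim ▸ one_ne_zero)) (.inl (hlim ▸ ENNReal.one_ne_top))
    _ = limsup u atTop := by rw [hlim, one_mul]

variable {S X : Type*} [Monoid X]

/-- The exponential growth rate of the gauge `g` along the products `seqProd A β n`, where the
sequence `β` is restricted to `Ω n`. The choices of `g` and `Ω` cover the joint, the generalized and
the periodic generalized spectral radius; the term at `n = 0`, in which `1 / 0 = 0`, is
immaterial. -/
noncomputable def growthRate (A : S → X) (Ω : ℕ → Set (ℕ → S)) (g : X → ℝ≥0∞) : ℝ≥0∞ :=
  limsup (fun n : ℕ => ⨆ β ∈ Ω n, g (seqProd A β n) ^ (1 / (n : ℝ))) atTop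

theorem growthRate_mono {A : S → X} {Ω Ω' : ℕ → Set (ℕ → S)} {g : X → ℝ≥0∞}
    (h : ∀ n, Ω n ⊆ Ω' n) : growthRate A Ω g ≤ growthRate A Ω' g :=
  limsup_le_limsup (.of_forall fun n => biSup_mono (h n))

theorem growthRate_le_growthRate_of_le_mul {A : S → X} {Ω : ℕ → Set (ℕ → S)} {g g' : X → ℝ≥0∞}
    {C : ℝ≥0} (h : ∀ x, g x ≤ C * g' x) : growthRate A Ω g ≤ growthRate A Ω g' := by
  refine (limsup_le_limsup (.of_forall fun n => iSup₂_le fun β hβ => ?_)).trans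
    (limsup_rpow_one_div_mul_le C _)
  calc g (seqProd A β n) ^ (1 / (n : ℝ))
      ≤ (C * g' (seqProd A β n)) ^ (1 / (n : ℝ)) := by gcongr; exact h _
    _ = C ^ (1 / (n : ℝ)) * g' (seqProd A β n) ^ (1 / (n : ℝ)) :=
        ENNReal.mul_rpow_of_nonneg _ _ (by positivity)
    _ ≤ C ^ (1 / (n : ℝ)) * ⨆ β ∈ Ω n, g' (seqProd A β n) ^ (1 / (n : ℝ)) := by
        gcongr
        exact le_iSup₂ (f := fun β _ => g' (seqProd A β n) ^ (1 / (n : ℝ))) β hβ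

theorem growthRate_le_of_le_mul_pow {A : S → X} {Ω : ℕ → Set (ℕ → S)} {g : X → ℝ≥0∞} {C b : ℝ≥0}
    (h : ∀ n, ∀ β ∈ Ω n, g (seqProd A β n) ≤ C * b ^ n) : growthRate A Ω g ≤ b := by
  calc growthRate A Ω g ≤ limsup (fun n : ℕ => (C : ℝ≥0∞) ^ (1 / (n : ℝ)) * b) atTop := by
        refine limsup_le_limsup ((eventually_gt_atTop 0).mono fun n hn => iSup₂_le fun β hβ => ?_)
        calc g (seqProd A β n) ^ (1 / (n : ℝ)) ≤ (C * b ^ n) ^ (1 / (n : ℝ)) := by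
              gcongr
              exact h n β hβ
          _ = C ^ (1 / (n : ℝ)) * b := by
              rw [ENNReal.mul_rpow_of_nonneg _ _ (by positivity), one_div,
                ENNReal.pow_rpow_inv_natCast hn.ne']
    _ ≤ limsup (fun _ => (b : ℝ≥0∞)) atTop := limsup_rpow_one_div_mul_le C _
    _ = b := limsup_const _

-- An `n`-periodic sequence is also `n * k`-periodic, hence contributes at arbitrarily large times.
theorem le_growthRate_periodic_pow {A : S → X} {Ω : Set (ℕ → S)} {g : X → ℝ≥0∞}
    (hg : ∀ x k, k ≠ 0 → g x ^ k ≤ g (x ^ k)) {n : ℕ} (hn : 0 < n) {β : ℕ → S} (hβ : β ∈ Ω)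
    (hper : Function.Periodic β n) :
    g (seqProd A β n) ≤ growthRate A (fun n => {β ∈ Ω | Function.Periodic β n}) g ^ n := by
  suffices h : g (seqProd A β n) ^ (1 / (n : ℝ)) ≤
      growthRate A (fun n => {β ∈ Ω | Function.Periodic β n}) g by
    calc g (seqProd A β n) = (g (seqProd A β n) ^ (1 / (n : ℝ))) ^ n := by
          rw [one_div, ENNReal.rpow_inv_natCast_pow hn.ne']
      _ ≤ _ := by gcongr
  refine le_limsup_of_frequently_le (frequently_atTop.2 fun m =>
    ⟨n * (m + 1), m.le_succ.trans (Nat.le_mul_of_pos_left _ hn), le_iSup₂_of_le β ⟨hβ, ?_⟩ ?_⟩)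
  · simpa [mul_comm] using hper.nat_mul (m + 1)
  · calc g (seqProd A β n) ^ (1 / (n : ℝ))
        = (g (seqProd A β n) ^ (m + 1)) ^ (1 / ((n * (m + 1) : ℕ) : ℝ)) := by
          rw [← ENNReal.rpow_natCast, ← ENNReal.rpow_mul]
          congr 1
          push_cast
          field_simp
      _ ≤ g (seqProd A β n ^ (m + 1)) ^ (1 / ((n * (m + 1) : ℕ) : ℝ)) := by
          gcongr
          exact hg _ _ m.succ_ne_zero
      _ = g (seqProd A β (n * (m + 1))) ^ (1 / ((n * (m + 1) : ℕ) : ℝ)) := by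
          rw [seqProd_mul_of_periodic A hper]

end GrowthRate

theorem norm_seqProd_le {S R : Type*} [SeminormedRing R] {A : S → R} {b : ℝ≥0}
    (hA : ∀ t, ‖A t‖ ≤ b) (s : ℕ → S) (n : ℕ) : ‖seqProd A s n‖ ≤ ‖(1 : R)‖ * b ^ n := by
  induction n with
  | zero => simp [seqProd, initialWord]
  | succ n ih =>
    calc ‖seqProd A s (n + 1)‖ ≤ ‖A (s n)‖ * ‖seqProd A s n‖ := norm_mul_le _ _
      _ ≤ b * (‖(1 : R)‖ * b ^ n) := by gcongr; exact hA _
      _ = ‖(1 : R)‖ * b ^ (n + 1) := by ring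

section Matrices

open scoped Matrix.Norms.Frobenius

variable {𝕂 : Type*} [RCLike 𝕂] {d : ℕ}

variable (𝕂 d) in
/-- The inclusion of the matrices over `𝕂` into the complex ones, by means of which `specRad` is
defined. -/
noncomputable def toComplexMatrix : Matrix (Fin d) (Fin d) 𝕂 →+* Matrix (Fin d) (Fin d) ℂ :=
  RingHom.mapMatrix
    { (RCLike.map 𝕂 ℂ).toLinearMap.toAddMonoidHom with
      map_one' := by simp [RCLike.map_apply]
      map_mul' := fun a b => by apply Complex.ext <;> simp [RCLike.map_apply] }

theorem specRad_eq (X : Matrix (Fin d) (Fin d) 𝕂) :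
    specRad X = spectralRadius ℂ (toComplexMatrix 𝕂 d X) :=
  rfl

theorem norm_toComplexMatrix (X : Matrix (Fin d) (Fin d) 𝕂) : ‖toComplexMatrix 𝕂 d X‖ = ‖X‖ :=
  Matrix.frobenius_norm_map_eq X _ RCLike.norm_to_complex

theorem specRad_pow_le (X : Matrix (Fin d) (Fin d) 𝕂) (k : ℕ) (hk : k ≠ 0) :
    specRad X ^ k ≤ specRad (X ^ k) := by
  rw [specRad_eq, specRad_eq, map_pow]
  exact spectrum.spectralRadius_pow_le _ k hk

theorem exists_specRad_le_mul {N : Seminorm 𝕂 (Matrix (Fin d) (Fin d) 𝕂)}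
    (hN : ∀ X, N X = 0 → X = 0) : ∃ C : ℝ≥0, ∀ X, specRad X ≤ C * ENNReal.ofReal (N X) := by
  obtain ⟨C, hC⟩ := exists_seminorm_le_mul hN (normSeminorm 𝕂 _)
  let K := ‖(1 : Matrix (Fin d) (Fin d) ℂ)‖₊
  refine ⟨K * C, fun X => iSup₂_le fun z hz => ?_⟩
  have hnorm : ‖z‖ ≤ (K * C : ℝ≥0) * N X :=
    calc ‖z‖ ≤ ‖toComplexMatrix 𝕂 d X‖ * K := spectrum.norm_le_norm_mul_of_mem hz
      _ ≤ (C * N X) * K := by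
          rw [norm_toComplexMatrix]
          gcongr
          exact hC X
      _ = (K * C : ℝ≥0) * N X := by push_cast; ring
  rw [← enorm_eq_nnnorm, ← ofReal_norm, ← ENNReal.ofReal_coe_nnreal,
    ← ENNReal.ofReal_mul NNReal.zero_le_coe]
  exact ENNReal.ofReal_le_ofReal hnorm

variable {S : Type*} [Finite S]

theorem growthRate_seminorm_ne_top (M : S → Matrix (Fin d) (Fin d) 𝕂) (Ω : ℕ → Set (ℕ → S))
    (N : Seminorm 𝕂 (Matrix (Fin d) (Fin d) 𝕂)) :
    growthRate M Ω (fun X => ENNReal.ofReal (N X)) ≠ ∞ := by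
  obtain ⟨C, hC⟩ := exists_seminorm_le_mul (N := normSeminorm 𝕂 _) (fun _ h => norm_eq_zero.1 h) N
  obtain ⟨b, hb⟩ := Finite.exists_le fun t => ‖M t‖₊
  let K := ‖(1 : Matrix (Fin d) (Fin d) 𝕂)‖₊
  refine ne_top_of_le_ne_top ENNReal.coe_ne_top
    (growthRate_le_of_le_mul_pow (C := C * K) (b := b) fun n β _ => ?_)
  refine ENNReal.ofReal_le_of_le_toReal ?_
  calc N (seqProd M β n) ≤ C * ‖seqProd M β n‖ := hC _
    _ ≤ C * (K * b ^ n) := by gcongr; exact norm_seqProd_le hb β n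
    _ = (((C * K : ℝ≥0) : ℝ≥0∞) * b ^ n).toReal := by simp [mul_assoc]

theorem growthRate_seminorm_le_growthRate_periodic_specRad {l : ℕ} (B : Set (Fin (l + 1) → S))
    (M : S → Matrix (Fin d) (Fin d) 𝕂) (N : Seminorm 𝕂 (Matrix (Fin d) (Fin d) 𝕂)) :
    growthRate M (fun _ => blockShift B) (fun X => ENNReal.ofReal (N X)) ≤
      growthRate M (fun n => {β ∈ blockShift B | Function.Periodic β n}) specRad := by
  refine le_of_forall_gt_imp_ge_of_dense fun b hb => ?_
  obtain ⟨c', hc', hc'b⟩ := ENNReal.lt_iff_exists_nnreal_btwn.1 hb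
  obtain ⟨c, hc, hcc'⟩ := ENNReal.lt_iff_exists_nnreal_btwn.1 hc'
  refine le_trans ?_ hc'b.le
  have hspec : ∀ β ∈ blockShift B, ∀ n, 0 < n → Function.Periodic β n →
      ∀ z ∈ spectrum ℂ (seqProd (toComplexMatrix 𝕂 d ∘ M) β n), ‖z‖ ≤ c ^ n := by
    intro β hβ n hn hper z hz
    have hzc : (‖z‖₊ : ℝ≥0∞) ≤ c ^ n :=
      calc (‖z‖₊ : ℝ≥0∞) ≤ specRad (seqProd M β n) := by
            rw [specRad_eq]
            exact le_iSup₂_of_le z (by rwa [map_seqProd]) le_rfl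
        _ ≤ _ := le_growthRate_periodic_pow specRad_pow_le hn hβ hper
        _ ≤ c ^ n := by gcongr
    exact_mod_cast hzc
  obtain ⟨C, hC⟩ := exists_seminorm_seqProd_le (ENNReal.coe_lt_coe.1 hcc') hspec
    (normSeminorm ℂ (Matrix (Fin d) (Fin d) ℂ))
  obtain ⟨K, hK⟩ := exists_seminorm_le_mul (N := normSeminorm 𝕂 _) (fun _ h => norm_eq_zero.1 h) N
  refine growthRate_le_of_le_mul_pow (C := K * C) fun n β hβ => ENNReal.ofReal_le_of_le_toReal ?_
  calc N (seqProd M β n) ≤ K * ‖toComplexMatrix 𝕂 d (seqProd M β n)‖ := by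
        rw [norm_toComplexMatrix]
        exact hK _
    _ = K * ‖seqProd (toComplexMatrix 𝕂 d ∘ M) β n‖ := by
        rw [map_seqProd]
    _ ≤ K * (C * c' ^ n) := by gcongr; exact hC β hβ n
    _ = (((K * C : ℝ≥0) : ℝ≥0∞) * c' ^ n).toReal := by simp [mul_assoc]

end Matrices

section Admissible

variable {𝕂 : Type*} [RCLike 𝕂] {d r : ℕ}

theorem matProd_eq_seqProd (M : Fin r → Matrix (Fin d) (Fin d) 𝕂) (β : ℕ → Fin r) (n : ℕ) :
    matProd M (fun k : Fin n => β k) = seqProd M β n := by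
  rw [matProd, seqProd, initialWord_eq_reverse_ofFn, List.map_reverse, List.map_ofFn]
  rfl

variable (M : Fin r → Matrix (Fin d) (Fin d) 𝕂) (l : ℕ) (pm pp : Fin r → ℝ)

theorem iSup_admissible (g : Matrix (Fin d) (Fin d) 𝕂 → ℝ≥0∞) (n : ℕ) :
    ⨆ α ∈ admissible l pm pp n, g (matProd M α) =
      ⨆ β ∈ blockShift (blocks l pm pp), g (seqProd M β n) := by
  refine le_antisymm (iSup₂_le ?_) (iSup₂_le fun β hβ => ?_)
  · rintro α ⟨β, hβ, hβα⟩
    obtain rfl : (fun k : Fin n => β k) = α := funext hβα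
    exact le_iSup₂_of_le β hβ (by rw [matProd_eq_seqProd])
  · exact le_iSup₂_of_le _ ⟨β, hβ, fun _ => rfl⟩ (by rw [matProd_eq_seqProd])

theorem iSup_perAdmissible (g : Matrix (Fin d) (Fin d) 𝕂 → ℝ≥0∞) (n : ℕ) :
    ⨆ α ∈ perAdmissible l pm pp n, g (matProd M α) =
      ⨆ β ∈ {β ∈ blockShift (blocks l pm pp) | Function.Periodic β n}, g (seqProd M β n) := by
  refine le_antisymm (iSup₂_le ?_) (iSup₂_le fun β hβ => ?_)
  · rintro α ⟨-, β, hβ, hper, hβα⟩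
    obtain rfl : (fun k : Fin n => β k) = α := funext hβα
    exact le_iSup₂_of_le β ⟨hβ, hper⟩ (by rw [matProd_eq_seqProd])
  · exact le_iSup₂_of_le _ ⟨⟨β, hβ.1, fun _ => rfl⟩, β, hβ.1, hβ.2, fun _ => rfl⟩
      (by rw [matProd_eq_seqProd])

theorem jointRad_eq_growthRate (N : AlgebraNorm 𝕂 (Matrix (Fin d) (Fin d) 𝕂)) :
    jointRad N M l pm pp =
      growthRate M (fun _ => blockShift (blocks l pm pp)) (fun X => ENNReal.ofReal (N X)) :=
  congrArg (limsup · atTop) <| funext fun n =>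
    iSup_admissible M l pm pp (fun X => ENNReal.ofReal (N X) ^ (1 / (n : ℝ))) n

theorem genRad_eq_growthRate :
    genRad M l pm pp = growthRate M (fun _ => blockShift (blocks l pm pp)) specRad :=
  congrArg (limsup · atTop) <| funext fun n =>
    iSup_admissible M l pm pp (fun X => specRad X ^ (1 / (n : ℝ))) n

theorem perRad_eq_growthRate :
    perRad M l pm pp = growthRate M
      (fun n => {β ∈ blockShift (blocks l pm pp) | Function.Periodic β n}) specRad :=
  congrArg (limsup · atTop) <| funext fun n =>
    iSup_perAdmissible M l pm pp (fun X => specRad X ^ (1 / (n : ℝ))) n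

end Admissible

end ConstrainedJSR

open ConstrainedJSR in
theorem theorem2_general {𝕂 S : Type*} [RCLike 𝕂] [Finite S] {d l : ℕ}
    {N : Seminorm 𝕂 (Matrix (Fin d) (Fin d) 𝕂)} (hN : ∀ X, N X = 0 → X = 0)
    (M : S → Matrix (Fin d) (Fin d) 𝕂) (B : Set (Fin (l + 1) → S)) :
    growthRate M (fun _ => blockShift B) (fun X => ENNReal.ofReal (N X)) ≠ ∞ ∧
      growthRate M (fun n => {β ∈ blockShift B | Function.Periodic β n}) specRad =
        growthRate M (fun _ => blockShift B) (fun X => ENNReal.ofReal (N X)) ∧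
      growthRate M (fun _ => blockShift B) specRad =
        growthRate M (fun _ => blockShift B) (fun X => ENNReal.ofReal (N X)) := by
  obtain ⟨C, hC⟩ := exists_specRad_le_mul hN
  have hperGen : growthRate M (fun n => {β ∈ blockShift B | Function.Periodic β n}) specRad ≤
      growthRate M (fun _ => blockShift B) specRad := growthRate_mono fun _ => Set.sep_subset _ _
  have hgenJoint : growthRate M (fun _ => blockShift B) specRad ≤
      growthRate M (fun _ => blockShift B) (fun X => ENNReal.ofReal (N X)) :=
    growthRate_le_growthRate_of_le_mul hC
  have hjointPer := growthRate_seminorm_le_growthRate_periodic_specRad B M N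
  exact ⟨growthRate_seminorm_ne_top M _ N, (hperGen.trans hgenJoint).antisymm hjointPer,
    hgenJoint.antisymm (hjointPer.trans hperGen)⟩

theorem theorem2 {𝕂 : Type*} [RCLike 𝕂] {d r : ℕ}
    (N : AlgebraNorm 𝕂 (Matrix (Fin d) (Fin d) 𝕂))
    (M : Fin r → Matrix (Fin d) (Fin d) 𝕂)
    (l : ℕ) (hl : 1 ≤ l)
    (p pm pp : Fin r → ℝ)
    (hp_pos : ∀ i, 0 < p i) (hp_sum : ∑ i, p i = 1)
    (hpm_nonneg : ∀ i, 0 ≤ pm i) (hpm_lt : ∀ i, pm i < p i)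
    (hpp_lt : ∀ i, p i < pp i) (hpp_le : ∀ i, pp i ≤ 1) :
    ConstrainedJSR.jointRad N M l pm pp ≠ ∞ ∧
      ConstrainedJSR.perRad M l pm pp = ConstrainedJSR.jointRad N M l pm pp ∧
      ConstrainedJSR.genRad M l pm pp = ConstrainedJSR.jointRad N M l pm pp := by
  obtain ⟨l, rfl⟩ := Nat.exists_eq_add_of_le' hl
  rw [ConstrainedJSR.jointRad_eq_growthRate, ConstrainedJSR.genRad_eq_growthRate,
    ConstrainedJSR.perRad_eq_growthRate]
  exact theorem2_general (N := N.toSeminorm) (fun _ => eq_zero_of_map_eq_zero N) M _
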